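/- Let $s\in\{1,-1\}$, let $\chi_0,\chi_\infty\in\mathbb C$ be arbitrary constants, and let $t_0\in\mathbb C$, $t_0\neq 0$. For functions $\lambda,\mu$ holomorphic near $t_0$ put $$W_\lambda[\lambda,\mu](\delta,t)=\delta^{-1}\Big(\tfrac{s(\chi_0^2-1)}{2t_0}-1+2\mu(t)-3t_0\lambda(t)\Big)+\tfrac{(1-s\chi_0)(2\mu(t)-1)}{t_0}-(2+s\chi_0)\lambda(t)+\delta\,(2\mu(t)-1)\Big(2s\lambda(t)+\big(\tfrac{s-\chi_0}{2t_0}+\delta\lambda(t)\big)^2\Big),$$ $$W_\mu[\lambda,\mu](\delta,t)=-\tfrac12(\chi_\infty+s\chi_0-1)-(1-s\chi_0)\mu(t)-2\delta\,(\mu(t)-1)\mu(t)\Big(s+\delta\,\tfrac{s-\chi_0}{2t_0}+\delta^2\lambda(t)\Big),$$ and, with $\tau=t_0+\delta\sigma$, $$\Omega_\mu[\lambda,\mu](\sigma,\delta)=\mu(\tau)\Big(s\chi_0+2\delta\sigma\,(1-\mu(\tau))\big(s-\delta\sigma\tfrac{\chi_0-s}{2t_0}+\delta^2\sigma^2\lambda(\tau)\big)\Big),$$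 $$\begin{aligned}\Omega_\xi[\lambda,\mu](\sigma,\delta)={}&s\big(3(\chi_0-s)-8\chi_0\mu(\tau)-3(\chi_0-2s)t_0\lambda(\tau)\big)\\&+3\delta\sigma t_0(2\mu(\tau)-1)\Big(2s\lambda(\tau)+\big(\tfrac{\chi_0-s}{2t_0}-\delta\sigma\lambda(\tau)\big)^2\Big)\\&+4\delta\sigma(\mu(\tau)-1)\mu(\tau)\big(s-\delta\sigma\tfrac{\chi_0-s}{2t_0}+\delta^2\sigma^2\lambda(\tau)\big).\end{aligned}$$ Then for every constant $\lambda^{III}\in\mathbb C$ there exist functions $\lambda,\mu$, holomorphic in some disc centred at $t_0$, which satisfy in that disc the integral equations $$\mu(t)=\tfrac12\Big(1-\tfrac{s(\chi_0^2-1)}{2t_0}+3t_0\lambda(t_0)\Big)+\tfrac{t-t_0}{t_0}\Big(-\tfrac12(\chi_\infty+s\chi_0-1)-\mu(t)+\int_0^1\Omega_\mu[\lambda,\mu](\sigma,t-t_0)\,d\sigma\Big),$$ $$\lambda(t)=\lambda(t_0)-\tfrac{t-t_0}{t_0}\Big(\tfrac{\chi_\infty+s\chi_0-1}{4t_0}+\lambda(t)-\tfrac1{3t_0}\int_0^1\big(2\Omega_\mu[\lambda,\mu](\sigma,t-t_0)+\sigma^3\Omega_\xi[\lambda,\mu](\sigma,t-t_0)\big)d\sigma\Big),$$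 and which also satisfy there the differential equations $$t\,\dot\lambda(t)=W_\lambda[\lambda,\mu](t-t_0,t),\qquad t\,\dot\mu(t)=W_\mu[\lambda,\mu](t-t_0,t)$$ (at $t=t_0$ the right-hand side of the first one is understood as its limit as $t\to t_0$), with the initial values $$\lambda(t_0)=\lambda^{III},\qquad \mu(t_0)=\tfrac12\Big(1+\tfrac{s(1-\chi_0^2)}{2t_0}+3t_0\lambda^{III}\Big).$$ -/

import Mathlib

open scoped Topology

/-! Differential and integral equations for the third-order remainder `lam` of a third
Painlevé transcendent near its root `t₀` and for the conjugate momentum `mu`.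
Throughout, `s` is the sign switch, `χ₀`, `χi` (chi with index infinity) are the constant
parameters, `t₀` is the root, and `δ` stands for `t - t₀`. -/

namespace PainleveRoot

noncomputable section

/-- The right-hand side `W_λ[lam, mu](δ, t)` of the differential equation for `lam`
(for `δ ≠ 0`). -/
def WLam (s χ₀ t₀ : ℂ) (lam mu : ℂ → ℂ) (δ t : ℂ) : ℂ :=
  (s * (χ₀ ^ 2 - 1) / (2 * t₀) - 1 + 2 * mu t - 3 * t₀ * lam t) / δ
    + (1 - s * χ₀) * (2 * mu t - 1) / t₀
    - (2 + s * χ₀) * lam t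
    + δ * (2 * mu t - 1) * (2 * s * lam t + ((s - χ₀) / (2 * t₀) + δ * lam t) ^ 2)

/-- The right-hand side `W_μ[lam, mu](δ, t)` of the differential equation for `mu`. -/
def WMu (s χ₀ χi t₀ : ℂ) (lam mu : ℂ → ℂ) (δ t : ℂ) : ℂ :=
  -(χi + s * χ₀ - 1) / 2 - (1 - s * χ₀) * mu t
    - 2 * δ * (mu t - 1) * mu t * (s + δ * (s - χ₀) / (2 * t₀) + δ ^ 2 * lam t)

/-- The kernel `Ω_μ[lam, mu](σ, δ)`; the unknowns are evaluated at `τ = t₀ + δ σ`. -/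
def OmegaMu (s χ₀ t₀ : ℂ) (lam mu : ℂ → ℂ) (σ δ : ℂ) : ℂ :=
  let τ := t₀ + δ * σ
  mu τ * (s * χ₀ + 2 * δ * σ * (1 - mu τ) *
    (s - δ * σ * (χ₀ - s) / (2 * t₀) + δ ^ 2 * σ ^ 2 * lam τ))

/-- The kernel `Ω_ξ[lam, mu](σ, δ)`; the unknowns are evaluated at `τ = t₀ + δ σ`. -/
def OmegaXi (s χ₀ t₀ : ℂ) (lam mu : ℂ → ℂ) (σ δ : ℂ) : ℂ :=
  let τ := t₀ + δ * σ
  s * (3 * (χ₀ - s) - 8 * χ₀ * mu τ - 3 * (χ₀ - 2 * s) * t₀ * lam τ)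
    + 3 * δ * σ * t₀ * (2 * mu τ - 1) *
        (2 * s * lam τ + ((χ₀ - s) / (2 * t₀) - δ * σ * lam τ) ^ 2)
    + 4 * δ * σ * (mu τ - 1) * mu τ *
        (s - δ * σ * (χ₀ - s) / (2 * t₀) + δ ^ 2 * σ ^ 2 * lam τ)

/-- The kernel of the (refined) integral equation for `lam`. -/
def OmegaLam (s χ₀ t₀ : ℂ) (lam mu : ℂ → ℂ) (σ δ : ℂ) : ℂ :=
  2 * OmegaMu s χ₀ t₀ lam mu σ δ + σ ^ 3 * OmegaXi s χ₀ t₀ lam mu σ δ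

/-- The integral equation for `mu`, on the set `U`. -/
def IntEqMu (s χ₀ χi t₀ : ℂ) (lam mu : ℂ → ℂ) (U : Set ℂ) : Prop :=
  ∀ t ∈ U, mu t =
    (1 - s * (χ₀ ^ 2 - 1) / (2 * t₀) + 3 * t₀ * lam t₀) / 2
      + (t - t₀) / t₀ * (-(χi + s * χ₀ - 1) / 2 - mu t
          + ∫ σ in (0 : ℝ)..1, OmegaMu s χ₀ t₀ lam mu (σ : ℂ) (t - t₀))

/-- The (refined) integral equation for `lam`, on the set `U`. -/
def IntEqLam (s χ₀ χi t₀ : ℂ) (lam mu : ℂ → ℂ) (U : Set ℂ) : Prop :=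
  ∀ t ∈ U, lam t =
    lam t₀ - (t - t₀) / t₀ * ((χi + s * χ₀ - 1) / (4 * t₀) + lam t
      - 1 / (3 * t₀) * ∫ σ in (0 : ℝ)..1, OmegaLam s χ₀ t₀ lam mu (σ : ℂ) (t - t₀))

/-- The differential equation `t lam'(t) = W_λ[lam, mu](t - t₀, t)` on the set `U`.  Its
right-hand side contains a division by `t - t₀`, so at `t = t₀` it is read as its limit. -/
def ODELam (s χ₀ t₀ : ℂ) (lam mu : ℂ → ℂ) (U : Set ℂ) : Prop :=
  (∀ t ∈ U, t ≠ t₀ → t * deriv lam t = WLam s χ₀ t₀ lam mu (t - t₀) t) ∧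
    (t₀ ∈ U → Filter.Tendsto (fun t => WLam s χ₀ t₀ lam mu (t - t₀) t) (𝓝[≠] t₀)
      (𝓝 (t₀ * deriv lam t₀)))

/-- The differential equation `t mu'(t) = W_μ[lam, mu](t - t₀, t)` on the set `U`. -/
def ODEMu (s χ₀ χi t₀ : ℂ) (lam mu : ℂ → ℂ) (U : Set ℂ) : Prop :=
  ∀ t ∈ U, t * deriv mu t = WMu s χ₀ χi t₀ lam mu (t - t₀) t

end

end PainleveRoot

/-! Put `z = t - t₀`. The integral equations then read `f = f₀ + z (L + R₀ P + R₃ Q)` for `f = (lam,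
mu)`, where `R_k g (z) = ∫ σ^k g(zσ) dσ` over `[0, 1]` and `L`, `P`, `Q` are polynomial in `z` and
`f`. The factor `z` makes the right-hand side a contraction on a small disc, and a uniform limit of
holomorphic iterates is holomorphic (`exists_holomorphic_solution`). The differential equations
follow from the Euler relation `z (R_k g)' + (k + 1) R_k g = g`: differentiating the integral
equations and combining the results eliminates the averages
(`differentialEquations_of_integralEquations`). The weight `σ³` matches the singular part `z lam' +
3 lam` of the first equation, and the prescribed `mu t₀` is exactly what cancels its pole at `z =
0`. -/

/-! ### Fixed points of contractions on holomorphic maps. -/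

open Metric Set in
/-- A self-map of the holomorphic functions from a disc into a closed ball that contracts
uniform distances by a factor two has a fixed point. -/
theorem exists_holomorphic_fixedPoint {E : Type*} [NormedAddCommGroup E] [NormedSpace ℂ E]
    [CompleteSpace E] {r R : ℝ} (hR : 0 ≤ R) (f₀ : E) (T : (ℂ → E) → ℂ → E)
    (hT : ∀ f : ℂ → E, DifferentiableOn ℂ f (ball 0 r) → MapsTo f (ball 0 r) (closedBall f₀ R) →
      DifferentiableOn ℂ (T f) (ball 0 r) ∧ MapsTo (T f) (ball 0 r) (closedBall f₀ R))
    (hc : ∀ f g : ℂ → E,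
      DifferentiableOn ℂ f (ball 0 r) → MapsTo f (ball 0 r) (closedBall f₀ R) →
      DifferentiableOn ℂ g (ball 0 r) → MapsTo g (ball 0 r) (closedBall f₀ R) →
      ∀ d : ℝ, (∀ z ∈ ball (0 : ℂ) r, dist (f z) (g z) ≤ d) →
        ∀ z ∈ ball (0 : ℂ) r, dist (T f z) (T g z) ≤ d / 2) :
    ∃ f : ℂ → E, DifferentiableOn ℂ f (ball 0 r) ∧ MapsTo f (ball 0 r) (closedBall f₀ R) ∧
      ∀ z ∈ ball (0 : ℂ) r, f z = T f z := by
  set F : ℕ → ℂ → E := fun n => T^[n] (fun _ => f₀) with hF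
  have hsucc : ∀ n, F (n + 1) = T (F n) := fun n => Function.iterate_succ_apply' T n _
  have hS : ∀ n, DifferentiableOn ℂ (F n) (ball 0 r) ∧
      MapsTo (F n) (ball 0 r) (closedBall f₀ R) := by
    intro n
    induction n with
    | zero => exact ⟨differentiableOn_const f₀, fun z _ => mem_closedBall_self hR⟩
    | succ n ih => rw [hsucc]; exact hT _ ih.1 ih.2
  -- The first step has length at most `R`, and each later one is halved; `2 * R / 2` is the shape
  -- required by the geometric-series lemmas.
  have hstep : ∀ n, ∀ z ∈ ball (0 : ℂ) r, dist (F n z) (F (n + 1) z) ≤ (2 * R) / 2 / 2 ^ n := by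
    intro n
    induction n with
    | zero =>
      intro z hz
      have h := (hS 1).2 hz
      rw [mem_closedBall, dist_comm] at h
      simpa [hF] using h
    | succ n ih =>
      intro z hz
      rw [hsucc (n + 1)]
      nth_rewrite 1 [hsucc n]
      refine (hc _ _ (hS n).1 (hS n).2 (hS (n + 1)).1 (hS (n + 1)).2 _ ih z hz).trans_eq ?_
      rw [pow_succ]; ring
  have hlim : ∀ z ∈ ball (0 : ℂ) r, ∃ y, Filter.Tendsto (fun n => F n z) Filter.atTop (𝓝 y) :=
    fun z hz => cauchySeq_tendsto_of_complete
      (cauchySeq_of_le_geometric_two (fun n => hstep n z hz))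
  choose! f hf using hlim
  have hdist : ∀ n, ∀ z ∈ ball (0 : ℂ) r, dist (F n z) (f z) ≤ 2 * R / 2 ^ n := fun n z hz =>
    dist_le_of_le_geometric_two_of_tendsto (fun n => hstep n z hz) (hf z hz) n
  have hzero : Filter.Tendsto (fun n : ℕ => 2 * R / 2 ^ n) Filter.atTop (𝓝 0) := by
    have := (tendsto_pow_atTop_nhds_zero_of_lt_one (r := (1 / 2 : ℝ)) (by norm_num)
      (by norm_num)).const_mul (2 * R)
    simpa [div_eq_mul_inv] using this
  have hunif : TendstoUniformlyOn F f Filter.atTop (ball 0 r) := by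
    rw [Metric.tendstoUniformlyOn_iff]
    intro ε hε
    filter_upwards [hzero.eventually (gt_mem_nhds hε)] with n hn z hz
    rw [dist_comm]
    exact (hdist n z hz).trans_lt hn
  have hfd : DifferentiableOn ℂ f (ball 0 r) :=
    hunif.tendstoLocallyUniformlyOn.differentiableOn (.of_forall fun n => (hS n).1) isOpen_ball
  have hfm : MapsTo f (ball 0 r) (closedBall f₀ R) := fun z hz =>
    isClosed_closedBall.mem_of_tendsto (hf z hz) (.of_forall fun n => (hS n).2 hz)
  refine ⟨f, hfd, hfm, fun z hz => ?_⟩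
  -- The iterates also tend to `T f z`, since the uniform distance from `F n` to `f` tends to zero
  -- and `T` halves it.
  refine tendsto_nhds_unique ((Filter.tendsto_add_atTop_iff_nat 1).2 (hf z hz)) ?_
  rw [tendsto_iff_dist_tendsto_zero]
  refine squeeze_zero (fun _ => dist_nonneg) (fun n => ?_) (by simpa using hzero.div_const 2)
  rw [hsucc]
  exact hc _ _ (hS n).1 (hS n).2 hfd hfm _ (hdist n) z hz

/-! ### Weighted radial averages of holomorphic maps. -/

/-- The weighted average of `g` over the segment from `0` to `z`. -/
noncomputable def radialIntegral {E : Type*} [NormedAddCommGroup E] [NormedSpace ℂ E]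
    (k : ℕ) (g : ℂ → E) (z : ℂ) : E :=
  ∫ σ in (0 : ℝ)..1, (σ : ℂ) ^ k • g (z * σ)

section radialIntegral

open Metric Set

variable {E : Type*} [NormedAddCommGroup E] [NormedSpace ℂ E] {r : ℝ} {g h : ℂ → E} {z : ℂ}

theorem mul_ofReal_mem_ball (hz : z ∈ ball (0 : ℂ) r) {σ : ℝ} (hσ : σ ∈ Icc (0 : ℝ) 1) :
    z * σ ∈ ball (0 : ℂ) r := by
  rw [mem_ball_zero_iff] at *
  rw [norm_mul, Complex.norm_of_nonneg hσ.1]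
  exact (mul_le_of_le_one_right (norm_nonneg _) hσ.2).trans_lt hz

theorem continuousOn_radial (k : ℕ) (hg : ContinuousOn g (ball 0 r)) (hz : z ∈ ball (0 : ℂ) r) :
    ContinuousOn (fun σ : ℝ => (σ : ℂ) ^ k • g (z * σ)) (Icc 0 1) := by
  refine ContinuousOn.smul (by fun_prop) (hg.comp (by fun_prop) fun σ hσ => ?_)
  exact mul_ofReal_mem_ball hz hσ

theorem intervalIntegrable_radial (k : ℕ) (hg : ContinuousOn g (ball 0 r))
    (hz : z ∈ ball (0 : ℂ) r) :
    IntervalIntegrable (fun σ : ℝ => (σ : ℂ) ^ k • g (z * σ)) MeasureTheory.volume 0 1 :=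
  ContinuousOn.intervalIntegrable (by
    rw [uIcc_of_le zero_le_one]; exact continuousOn_radial k hg hz)

theorem norm_radialIntegral_le (k : ℕ) {C : ℝ} (hg : ∀ w ∈ ball (0 : ℂ) r, ‖g w‖ ≤ C)
    (hz : z ∈ ball (0 : ℂ) r) : ‖radialIntegral k g z‖ ≤ C := by
  have := intervalIntegral.norm_integral_le_of_norm_le_const (a := (0 : ℝ)) (b := 1)
    (f := fun σ : ℝ => (σ : ℂ) ^ k • g (z * σ)) (C := C) (fun σ hσ => ?_)
  · simpa [radialIntegral] using this
  · rw [uIoc_of_le zero_le_one] at hσ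
    have hσ' : σ ∈ Icc (0 : ℝ) 1 := ⟨hσ.1.le, hσ.2⟩
    rw [norm_smul, norm_pow, Complex.norm_of_nonneg hσ'.1]
    have h1 := hg _ (mul_ofReal_mem_ball hz hσ')
    exact (mul_le_of_le_one_left (norm_nonneg _) (pow_le_one₀ hσ'.1 hσ'.2)).trans h1

theorem radialIntegral_sub (k : ℕ) (hg : ContinuousOn g (ball 0 r))
    (hh : ContinuousOn h (ball 0 r)) (hz : z ∈ ball (0 : ℂ) r) :
    radialIntegral k (fun w => g w - h w) z = radialIntegral k g z - radialIntegral k h z := by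
  simp only [radialIntegral, smul_sub]
  exact intervalIntegral.integral_sub (intervalIntegrable_radial k hg hz)
    (intervalIntegrable_radial k hh hz)

theorem hasDerivAt_radialIntegral [CompleteSpace E] (k : ℕ) (hg : DifferentiableOn ℂ g (ball 0 r))
    (hz : z ∈ ball (0 : ℂ) r) :
    HasDerivAt (radialIntegral k g) (radialIntegral (k + 1) (deriv g) z) z := by
  have hg' : ContinuousOn (deriv g) (ball 0 r) := (hg.deriv isOpen_ball).continuousOn
  -- `deriv g` may be unbounded on the open disc; a smaller closed disc around `0` containing `z`
  -- supplies the dominating constant.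
  obtain ⟨ρ, hzρ, hρr⟩ := exists_between (mem_ball_zero_iff.1 hz)
  have hsub : closedBall (0 : ℂ) ρ ⊆ ball 0 r := closedBall_subset_ball hρr
  obtain ⟨C, hC⟩ := (isCompact_closedBall (0 : ℂ) ρ).exists_bound_of_continuousOn (hg'.mono hsub)
  have hballρ : ball (0 : ℂ) ρ ⊆ ball 0 r := ball_subset_ball hρr.le
  have hnhds : ball (0 : ℂ) ρ ∈ 𝓝 z := isOpen_ball.mem_nhds (mem_ball_zero_iff.2 hzρ)
  have hIoc : ∀ {σ : ℝ}, σ ∈ uIoc (0 : ℝ) 1 → σ ∈ Icc (0 : ℝ) 1 := fun hσ => by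
    rw [uIoc_of_le zero_le_one] at hσ
    exact ⟨hσ.1.le, hσ.2⟩
  refine (intervalIntegral.hasDerivAt_integral_of_dominated_loc_of_deriv_le
    (F := fun w (σ : ℝ) => (σ : ℂ) ^ k • g (w * σ))
    (F' := fun w (σ : ℝ) => (σ : ℂ) ^ (k + 1) • deriv g (w * σ)) (bound := fun _ => C)
    hnhds ?_ (intervalIntegrable_radial k hg.continuousOn hz) ?_ ?_ ?_ ?_).2
  · filter_upwards [hnhds] with w hw
    exact (intervalIntegrable_radial k hg.continuousOn (hballρ hw)).aestronglyMeasurable_restrict_uIoc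
  · exact (intervalIntegrable_radial (k + 1) hg' hz).aestronglyMeasurable_restrict_uIoc
  · refine .of_forall fun σ hσ w hw => ?_
    have hσ' := hIoc hσ
    rw [norm_smul, norm_pow, Complex.norm_of_nonneg hσ'.1]
    exact (mul_le_of_le_one_left (norm_nonneg _) (pow_le_one₀ hσ'.1 hσ'.2)).trans
      (hC _ (ball_subset_closedBall (mul_ofReal_mem_ball hw hσ')))
  · exact intervalIntegrable_const
  · refine .of_forall fun σ hσ w hw => ?_
    have hd := (hg.differentiableAt (isOpen_ball.mem_nhds
      (mul_ofReal_mem_ball (hballρ hw) (hIoc hσ)))).hasDerivAt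
    have := (hd.scomp w ((hasDerivAt_id w).mul_const (σ : ℂ))).const_smul ((σ : ℂ) ^ k)
    refine this.congr_deriv ?_
    simp only [one_mul, smul_smul, pow_succ]

/-- Applied to the coordinate projections, this splits a vector equation into its components. -/
theorem ContinuousLinearMap.map_radialIntegral [CompleteSpace E] {F : Type*}
    [NormedAddCommGroup F] [NormedSpace ℂ F] [CompleteSpace F] (ℓ : E →L[ℂ] F) (k : ℕ)
    (hg : ContinuousOn g (ball 0 r)) (hz : z ∈ ball (0 : ℂ) r) :
    ℓ (radialIntegral k g z) = radialIntegral k (fun w => ℓ (g w)) z := by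
  simp only [radialIntegral, ← map_smul]
  exact (ℓ.intervalIntegral_comp_comm (intervalIntegrable_radial k hg hz)).symm

theorem radialIntegral_const_mul (k : ℕ) (c : ℂ) (g : ℂ → ℂ) (z : ℂ) :
    radialIntegral k (fun w => c * g w) z = c * radialIntegral k g z := by
  simp only [radialIntegral, smul_eq_mul, mul_left_comm _ c]
  exact intervalIntegral.integral_const_mul _ _

theorem differentiableOn_radialIntegral [CompleteSpace E] (k : ℕ)
    (hg : DifferentiableOn ℂ g (ball 0 r)) :
    DifferentiableOn ℂ (radialIntegral k g) (ball 0 r) := fun _ hz =>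
  (hasDerivAt_radialIntegral k hg hz).differentiableAt.differentiableWithinAt

/-- The Euler-type equation satisfied by the weighted radial average. -/
theorem mul_deriv_radialIntegral_add {g : ℂ → ℂ} (k : ℕ) (hg : DifferentiableOn ℂ g (ball 0 r))
    (hz : z ∈ ball (0 : ℂ) r) :
    z * deriv (radialIntegral k g) z + (k + 1) * radialIntegral k g z = g z := by
  have hg' : ContinuousOn (deriv g) (ball 0 r) := (hg.deriv isOpen_ball).continuousOn
  have hI₀ := intervalIntegrable_radial k hg.continuousOn hz
  have hI₁ := intervalIntegrable_radial (k + 1) hg' hz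
  -- The integrand is the `σ`-derivative of `σ ^ (k + 1) * g (z * σ)`, which vanishes at `σ = 0`
  -- because `k + 1 > 0`.
  have hFTC : ∫ σ in (0 : ℝ)..1, (z * ((σ : ℂ) ^ (k + 1) • deriv g (z * σ))
      + (k + 1) * ((σ : ℂ) ^ k • g (z * σ))) = g z := by
    rw [intervalIntegral.integral_eq_sub_of_hasDerivAt
      (f := fun σ : ℝ => (σ : ℂ) ^ (k + 1) * g (z * σ))]
    · simp
    · intro σ hσ
      rw [uIcc_of_le zero_le_one] at hσ
      have hd := (hg.differentiableAt (isOpen_ball.mem_nhds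
        (mul_ofReal_mem_ball hz hσ))).hasDerivAt
      have hlin : HasDerivAt (fun w : ℂ => z * w) z (σ : ℂ) := by
        simpa using (hasDerivAt_id (σ : ℂ)).const_mul z
      have := (((hasDerivAt_pow (k + 1) (σ : ℂ)).mul
        (HasDerivAt.comp (σ : ℂ) hd hlin))).comp_ofReal
      refine this.congr_deriv ?_
      simp only [smul_eq_mul, Nat.cast_add, Nat.cast_one, Nat.add_sub_cancel, Function.comp]
      ring
    · exact (hI₁.const_mul z).add (hI₀.const_mul _)
  rw [intervalIntegral.integral_add (hI₁.const_mul z) (hI₀.const_mul _),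
    intervalIntegral.integral_const_mul, intervalIntegral.integral_const_mul] at hFTC
  rw [(hasDerivAt_radialIntegral k hg hz).deriv]
  exact hFTC

end radialIntegral

/-! ### Local solvability of the abstract integral equation. -/

-- On a compact convex ball a `C¹` map is bounded and, viewed over `ℝ`, Lipschitz; the larger
-- constant serves for both.
open Metric Set in
theorem exists_bound_lipschitz_closedBall_of_contDiff {F G : Type*} [NormedAddCommGroup F]
    [NormedSpace ℂ F] [ProperSpace F] [NormedAddCommGroup G] [NormedSpace ℂ G] {Q : F → G}
    (hQ : ContDiff ℂ 1 Q) (x₀ : F) (R : ℝ) :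
    ∃ C : ℝ, 0 ≤ C ∧ (∀ x ∈ closedBall x₀ R, ‖Q x‖ ≤ C) ∧
      ∀ x ∈ closedBall x₀ R, ∀ y ∈ closedBall x₀ R, ‖Q x - Q y‖ ≤ C * dist x y := by
  let _ : NormedSpace ℝ F := NormedSpace.restrictScalars ℝ ℂ F
  let _ : NormedSpace ℝ G := NormedSpace.restrictScalars ℝ ℂ G
  have hQ' : ContDiff ℝ 1 Q := hQ.restrict_scalars ℝ
  obtain ⟨C, hC⟩ := (isCompact_closedBall x₀ R).exists_bound_of_continuousOn
    hQ.continuous.continuousOn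
  obtain ⟨K, hK⟩ := hQ'.contDiffOn.exists_lipschitzOnWith one_ne_zero
    (convex_closedBall x₀ R) (isCompact_closedBall x₀ R)
  refine ⟨max C K, K.2.trans (le_max_right _ _), fun x hx => (hC x hx).trans (le_max_left _ _),
    fun x hx y hy => ?_⟩
  rw [← dist_eq_norm]
  exact (hK.dist_le_mul x hx y hy).trans
    (mul_le_mul_of_nonneg_right (le_max_right _ _) dist_nonneg)

open Metric Set in
/-- Local solvability, in holomorphic functions, of a Volterra-type equation with smooth
nonlinearities `L`, `P`, `Q` and radial averages of weights `1` and `σ ^ k`. -/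
theorem exists_holomorphic_solution {E : Type*} [NormedAddCommGroup E] [NormedSpace ℂ E]
    [ProperSpace E] (k : ℕ) (f₀ : E) {L P Q : ℂ × E → E} (hL : ContDiff ℂ 1 L)
    (hP : ContDiff ℂ 1 P) (hQ : ContDiff ℂ 1 Q) :
    ∃ r : ℝ, 0 < r ∧ ∃ f : ℂ → E, DifferentiableOn ℂ f (ball 0 r) ∧
      ∀ z ∈ ball (0 : ℂ) r, f z = f₀ + z • (L (z, f z)
        + radialIntegral 0 (fun w => P (w, f w)) z
        + radialIntegral k (fun w => Q (w, f w)) z) := by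
  obtain ⟨A, hA, hAb, hAl⟩ := exists_bound_lipschitz_closedBall_of_contDiff hL ((0 : ℂ), f₀) 1
  obtain ⟨B, hB, hBb, hBl⟩ := exists_bound_lipschitz_closedBall_of_contDiff hP ((0 : ℂ), f₀) 1
  obtain ⟨C, hC, hCb, hCl⟩ := exists_bound_lipschitz_closedBall_of_contDiff hQ ((0 : ℂ), f₀) 1
  set D : ℝ := A + B + C with hD
  have hD0 : 0 ≤ D := by positivity
  -- `r * D ≤ 1 / 2` gives both the self-map and the contraction property; the `+ 1` allows `D = 0`
  -- and ensures `r ≤ 1`, so `(z, f z)` stays in the unit ball where the bounds hold.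
  set r : ℝ := 1 / (2 * (D + 1)) with hr
  have hr0 : 0 < r := by positivity
  have hrD : r * D ≤ 1 / 2 := by
    rw [hr, div_mul_eq_mul_div, div_le_div_iff₀ (by positivity) (by norm_num)]; linarith
  have hr1 : r ≤ 1 := by
    rw [hr, div_le_one (by positivity)]; linarith
  have hmem : ∀ {f : ℂ → E}, MapsTo f (ball 0 r) (closedBall f₀ 1) →
      ∀ z ∈ ball (0 : ℂ) r, (z, f z) ∈ closedBall ((0 : ℂ), f₀) 1 := by
    intro f hf z hz
    rw [← closedBall_prod_same]
    exact ⟨ball_subset_closedBall (ball_subset_ball hr1 hz), hf hz⟩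
  have hdiff : ∀ {H : ℂ × E → E}, ContDiff ℂ 1 H → ∀ {f : ℂ → E},
      DifferentiableOn ℂ f (ball 0 r) →
      DifferentiableOn ℂ (fun w => H (w, f w)) (ball 0 r) := fun hH f hf =>
    (hH.differentiable one_ne_zero).comp_differentiableOn (differentiableOn_id.prodMk hf)
  refine ⟨r, hr0, ?_⟩
  refine (exists_holomorphic_fixedPoint (r := r) zero_le_one f₀
    (fun f z => f₀ + z • (L (z, f z) + radialIntegral 0 (fun w => P (w, f w)) z
        + radialIntegral k (fun w => Q (w, f w)) z)) ?_ ?_).imp fun f hf => ⟨hf.1, hf.2.2⟩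
  · intro f hfd hfm
    refine ⟨(differentiableOn_const f₀).add (differentiableOn_id.smul (((hdiff hL hfd).add
      (differentiableOn_radialIntegral 0 (hdiff hP hfd))).add
      (differentiableOn_radialIntegral k (hdiff hQ hfd)))), fun z hz => ?_⟩
    rw [mem_closedBall_iff_norm, add_sub_cancel_left, norm_smul]
    have h1 := hAb _ (hmem hfm z hz)
    have h2 := norm_radialIntegral_le 0 (fun w hw => hBb _ (hmem hfm w hw)) hz
    have h3 := norm_radialIntegral_le k (fun w hw => hCb _ (hmem hfm w hw)) hz
    have h4 := norm_add₃_le.trans (add_le_add (add_le_add h1 h2) h3)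
    have h5 := mul_le_mul (mem_ball_zero_iff.1 hz).le h4 (norm_nonneg _) hr0.le
    exact h5.trans (hrD.trans (by norm_num))
  · intro f g hfd hfm hgd hgm d hd z hz
    have hd0 : 0 ≤ d := dist_nonneg.trans (hd z hz)
    have hpair : ∀ w ∈ ball (0 : ℂ) r, dist (w, f w) (w, g w) ≤ d := fun w hw => by
      rw [Prod.dist_eq, dist_self]; exact max_le hd0 (hd w hw)
    have hlip : ∀ {H : ℂ × E → E} {K : ℝ}, 0 ≤ K →
        (∀ x ∈ closedBall ((0 : ℂ), f₀) 1, ∀ y ∈ closedBall ((0 : ℂ), f₀) 1,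
          ‖H x - H y‖ ≤ K * dist x y) →
        ∀ w ∈ ball (0 : ℂ) r, ‖H (w, f w) - H (w, g w)‖ ≤ K * d := fun hK hH w hw =>
      (hH _ (hmem hfm w hw) _ (hmem hgm w hw)).trans (mul_le_mul_of_nonneg_left (hpair w hw) hK)
    have h1 := hlip hA hAl z hz
    have h2 := norm_radialIntegral_le 0 (hlip hB hBl) hz
    have h3 := norm_radialIntegral_le k (hlip hC hCl) hz
    rw [radialIntegral_sub 0 (hdiff hP hfd).continuousOn (hdiff hP hgd).continuousOn hz] at h2
    rw [radialIntegral_sub k (hdiff hQ hfd).continuousOn (hdiff hQ hgd).continuousOn hz] at h3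
    rw [dist_add_left, dist_eq_norm, ← smul_sub, norm_smul, add_sub_add_comm, add_sub_add_comm]
    have h4 := norm_add₃_le.trans (add_le_add (add_le_add h1 h2) h3)
    have h5 := mul_le_mul (mem_ball_zero_iff.1 hz).le h4 (norm_nonneg _) hr0.le
    refine h5.trans ?_
    calc r * (A * d + B * d + C * d) = r * D * d := by rw [hD]; ring
      _ ≤ 1 / 2 * d := mul_le_mul_of_nonneg_right hrD hd0
      _ = d / 2 := by ring

/-! ### The integral equations and their differentiation. -/

namespace PainleveRoot

open Metric Set

/-- `OmegaMu` as a polynomial in `w = δ σ` and in the values of the unknowns. -/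
noncomputable def omegaMuPoly (s χ₀ t₀ w l m : ℂ) : ℂ :=
  m * (s * χ₀ + 2 * w * (1 - m) * (s - w * (χ₀ - s) / (2 * t₀) + w ^ 2 * l))

/-- `OmegaXi` as a polynomial in `w = δ σ` and in the values of the unknowns. -/
noncomputable def omegaXiPoly (s χ₀ t₀ w l m : ℂ) : ℂ :=
  s * (3 * (χ₀ - s) - 8 * χ₀ * m - 3 * (χ₀ - 2 * s) * t₀ * l)
    + 3 * w * t₀ * (2 * m - 1) * (2 * s * l + ((χ₀ - s) / (2 * t₀) - w * l) ^ 2)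
    + 4 * w * (m - 1) * m * (s - w * (χ₀ - s) / (2 * t₀) + w ^ 2 * l)

theorem contDiff_omegaMuPoly (s χ₀ t₀ : ℂ) :
    ContDiff ℂ 1 fun p : ℂ × ℂ × ℂ => omegaMuPoly s χ₀ t₀ p.1 p.2.1 p.2.2 := by
  unfold omegaMuPoly; fun_prop

theorem contDiff_omegaXiPoly (s χ₀ t₀ : ℂ) :
    ContDiff ℂ 1 fun p : ℂ × ℂ × ℂ => omegaXiPoly s χ₀ t₀ p.1 p.2.1 p.2.2 := by
  unfold omegaXiPoly; fun_prop

/-- The kernel of the equation for `lam` in terms of the regular part of the right-hand side of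
its differential equation. -/
theorem omegaXiPoly_eq {s χ₀ t₀ : ℂ} (ht₀ : t₀ ≠ 0) (hs : s ^ 2 = 1) (w l m : ℂ) :
    omegaXiPoly s χ₀ t₀ w l m = 3 * t₀ * ((1 - s * χ₀) * (2 * m - 1) / t₀ - (2 + s * χ₀) * l
        + w * (2 * m - 1) * (2 * s * l + ((s - χ₀) / (2 * t₀) + w * l) ^ 2))
      + 12 * t₀ * l - 2 * omegaMuPoly s χ₀ t₀ w l m - 6 * m := by
  have h : t₀ * t₀⁻¹ = 1 := mul_inv_cancel₀ ht₀
  unfold omegaXiPoly omegaMuPoly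
  linear_combination (-3 + 6 * t₀ * l) * hs - 3 * (1 - s * χ₀) * (2 * m - 1) * h

theorem integral_omegaMu (s χ₀ t₀ : ℂ) (a b : ℂ → ℂ) (z : ℂ) :
    ∫ σ in (0 : ℝ)..1, OmegaMu s χ₀ t₀ (fun t => a (t - t₀)) (fun t => b (t - t₀)) σ z
      = radialIntegral 0 (fun w => omegaMuPoly s χ₀ t₀ w (a w) (b w)) z := by
  unfold radialIntegral
  congr 1
  ext σ
  simp only [OmegaMu, omegaMuPoly, add_sub_cancel_left, smul_eq_mul, pow_zero]
  ring

theorem integral_omegaLam (s χ₀ t₀ : ℂ) {r : ℝ} {a b : ℂ → ℂ} (ha : ContinuousOn a (ball 0 r))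
    (hb : ContinuousOn b (ball 0 r)) {z : ℂ} (hz : z ∈ ball (0 : ℂ) r) :
    ∫ σ in (0 : ℝ)..1, OmegaLam s χ₀ t₀ (fun t => a (t - t₀)) (fun t => b (t - t₀)) σ z
      = 2 * radialIntegral 0 (fun w => omegaMuPoly s χ₀ t₀ w (a w) (b w)) z
        + radialIntegral 3 (fun w => omegaXiPoly s χ₀ t₀ w (a w) (b w)) z := by
  have hab : ContinuousOn (fun w => (w, a w, b w)) (ball (0 : ℂ) r) :=
    continuousOn_id.prodMk (ha.prodMk hb)
  have hm := (contDiff_omegaMuPoly s χ₀ t₀).continuous.comp_continuousOn hab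
  have hx := (contDiff_omegaXiPoly s χ₀ t₀).continuous.comp_continuousOn hab
  simp only [Function.comp_def] at hm hx
  unfold radialIntegral
  rw [← intervalIntegral.integral_const_mul, ← intervalIntegral.integral_add
    ((intervalIntegrable_radial 0 hm hz).const_mul 2) (intervalIntegrable_radial 3 hx hz)]
  congr 1
  ext σ
  simp only [OmegaLam, OmegaMu, OmegaXi, omegaMuPoly, omegaXiPoly, add_sub_cancel_left,
    smul_eq_mul, pow_zero]
  ring

/-- Holomorphic solution of the pair of integral equations, centred at the origin. -/
theorem exists_solution_integralEquations (s χ₀ t₀ c lam₀ mu₀ : ℂ) :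
    ∃ r : ℝ, 0 < r ∧ ∃ a b : ℂ → ℂ,
      DifferentiableOn ℂ a (ball 0 r) ∧ DifferentiableOn ℂ b (ball 0 r) ∧
      ∀ z ∈ ball (0 : ℂ) r,
        a z = lam₀ - z / t₀ * (c / (2 * t₀) + a z - 1 / (3 * t₀) *
          (2 * radialIntegral 0 (fun w => omegaMuPoly s χ₀ t₀ w (a w) (b w)) z
            + radialIntegral 3 (fun w => omegaXiPoly s χ₀ t₀ w (a w) (b w)) z)) ∧
        b z = mu₀ + z / t₀ * (-c - b z
          + radialIntegral 0 (fun w => omegaMuPoly s χ₀ t₀ w (a w) (b w)) z) := by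
  have hM := contDiff_omegaMuPoly s χ₀ t₀
  have hX := contDiff_omegaXiPoly s χ₀ t₀
  have hL : ContDiff ℂ 1 fun p : ℂ × ℂ × ℂ =>
      ((-(c / (2 * t₀)) - p.2.1) / t₀, (-c - p.2.2) / t₀) := by fun_prop
  have hP : ContDiff ℂ 1 fun p : ℂ × ℂ × ℂ =>
      (2 / (3 * t₀ * t₀) * omegaMuPoly s χ₀ t₀ p.1 p.2.1 p.2.2,
        1 / t₀ * omegaMuPoly s χ₀ t₀ p.1 p.2.1 p.2.2) :=
    (contDiff_const.mul hM).prodMk (contDiff_const.mul hM)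
  have hQ : ContDiff ℂ 1 fun p : ℂ × ℂ × ℂ =>
      -- Written as `0 * 0`, the second component lets `radialIntegral_const_mul` pull out a factor
      -- `0`, which `linear_combination` can discard.
      (1 / (3 * t₀ * t₀) * omegaXiPoly s χ₀ t₀ p.1 p.2.1 p.2.2, (0 : ℂ) * 0) :=
    (contDiff_const.mul hX).prodMk contDiff_const
  obtain ⟨r, hr, f, hf, hfe⟩ := exists_holomorphic_solution 3 (lam₀, mu₀) hL hP hQ
  refine ⟨r, hr, fun z => (f z).1, fun z => (f z).2, hf.fst, hf.snd, fun z hz => ?_⟩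
  have hcont : ContinuousOn (fun w => (w, f w)) (ball (0 : ℂ) r) :=
    continuousOn_id.prodMk hf.continuousOn
  have hPc := hP.continuous.comp_continuousOn hcont
  have hQc := hQ.continuous.comp_continuousOn hcont
  have h := hfe z hz
  have h1 := congrArg Prod.fst h
  have h2 := congrArg Prod.snd h
  have p1 := (ContinuousLinearMap.fst ℂ ℂ ℂ).map_radialIntegral 0 hPc hz
  have p2 := (ContinuousLinearMap.snd ℂ ℂ ℂ).map_radialIntegral 0 hPc hz
  have q1 := (ContinuousLinearMap.fst ℂ ℂ ℂ).map_radialIntegral 3 hQc hz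
  have q2 := (ContinuousLinearMap.snd ℂ ℂ ℂ).map_radialIntegral 3 hQc hz
  simp only [ContinuousLinearMap.coe_fst', ContinuousLinearMap.coe_snd', Function.comp_def,
    radialIntegral_const_mul] at p1 p2 q1 q2
  simp only [Prod.fst_add, Prod.snd_add, Prod.smul_fst, Prod.smul_snd, smul_eq_mul, p1, p2, q1,
    q2] at h1 h2
  constructor
  · linear_combination (exp := 1) h1
  · linear_combination (exp := 1) h2

/-- Solutions of the integral equations solve the differential equations, the one for `lam`
after multiplication by `z = t - t₀`. -/
theorem differentialEquations_of_integralEquations {s χ₀ t₀ c lam₀ mu₀ : ℂ} (ht₀ : t₀ ≠ 0)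
    (hs : s ^ 2 = 1) (hmu₀ : 2 * t₀ * (2 * mu₀) = 2 * t₀ + s * (1 - χ₀ ^ 2) + 6 * t₀ ^ 2 * lam₀)
    {r : ℝ} {a b : ℂ → ℂ} (ha : DifferentiableOn ℂ a (ball 0 r))
    (hb : DifferentiableOn ℂ b (ball 0 r))
    (hab : ∀ z ∈ ball (0 : ℂ) r,
        a z = lam₀ - z / t₀ * (c / (2 * t₀) + a z - 1 / (3 * t₀) *
          (2 * radialIntegral 0 (fun w => omegaMuPoly s χ₀ t₀ w (a w) (b w)) z
            + radialIntegral 3 (fun w => omegaXiPoly s χ₀ t₀ w (a w) (b w)) z)) ∧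
        b z = mu₀ + z / t₀ * (-c - b z
          + radialIntegral 0 (fun w => omegaMuPoly s χ₀ t₀ w (a w) (b w)) z))
    {z : ℂ} (hz : z ∈ ball (0 : ℂ) r) :
    z * ((t₀ + z) * deriv a z) = (s * (χ₀ ^ 2 - 1) / (2 * t₀) - 1 + 2 * b z - 3 * t₀ * a z)
      + z * ((1 - s * χ₀) * (2 * b z - 1) / t₀ - (2 + s * χ₀) * a z
        + z * (2 * b z - 1) * (2 * s * a z + ((s - χ₀) / (2 * t₀) + z * a z) ^ 2)) ∧
    (t₀ + z) * deriv b z = -c - (1 - s * χ₀) * b z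
      - 2 * z * (b z - 1) * b z * (s + z * (s - χ₀) / (2 * t₀) + z ^ 2 * a z) := by
  have hpair : DifferentiableOn ℂ (fun w => (w, a w, b w)) (ball (0 : ℂ) r) :=
    differentiableOn_id.prodMk (ha.prodMk hb)
  have hm := ((contDiff_omegaMuPoly s χ₀ t₀).differentiable one_ne_zero).comp_differentiableOn
    hpair
  have hx := ((contDiff_omegaXiPoly s χ₀ t₀).differentiable one_ne_zero).comp_differentiableOn
    hpair
  simp only [Function.comp_def] at hm hx
  have eM := mul_deriv_radialIntegral_add 0 hm hz
  have eX := mul_deriv_radialIntegral_add 3 hx hz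
  have hdM := (hasDerivAt_radialIntegral 0 hm hz).differentiableAt.hasDerivAt
  have hdX := (hasDerivAt_radialIntegral 3 hx hz).differentiableAt.hasDerivAt
  set M := radialIntegral 0 (fun w => omegaMuPoly s χ₀ t₀ w (a w) (b w))
  set X := radialIntegral 3 (fun w => omegaXiPoly s χ₀ t₀ w (a w) (b w))
  have hnhds : ball (0 : ℂ) r ∈ 𝓝 z := isOpen_ball.mem_nhds hz
  have hda := (ha.differentiableAt hnhds).hasDerivAt
  have hdb := (hb.differentiableAt hnhds).hasDerivAt
  -- Clearing `t₀` and moving the unknown to the left produces the factor `t = t₀ + w`.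
  have hB : ∀ w ∈ ball (0 : ℂ) r, (t₀ + w) * b w = t₀ * mu₀ + w * (-c + M w) := by
    intro w hw
    have h := (hab w hw).2
    field_simp at h
    linear_combination h
  have hA : ∀ w ∈ ball (0 : ℂ) r,
      6 * t₀ * ((t₀ + w) * a w) = 6 * t₀ ^ 2 * lam₀ + w * (-(3 * c) + 2 * (2 * M w + X w)) := by
    intro w hw
    have h := (hab w hw).1
    field_simp at h
    linear_combination h
  have hz' := hasDerivAt_id z
  have dB : b z + (t₀ + z) * deriv b z = -c + M z + z * deriv M z := by
    have h1 := (hz'.const_add t₀).mul hdb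
    have h2 := (hz'.mul (hdM.const_add (-c))).const_add (t₀ * mu₀)
    have h3 := h1.unique (h2.congr_of_eventuallyEq (Filter.eventuallyEq_of_mem hnhds hB))
    simp only [id] at h3
    linear_combination h3
  have dA : 6 * t₀ * (a z + (t₀ + z) * deriv a z) = -(3 * c) + 2 * (2 * M z + X z)
      + z * (2 * (2 * deriv M z + deriv X z)) := by
    have h1 := ((hz'.const_add t₀).mul hda).const_mul (6 * t₀)
    have h2 := (hz'.mul ((((hdM.const_mul 2).add hdX).const_mul 2).const_add (-(3 * c)))).const_add
      (6 * t₀ ^ 2 * lam₀)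
    have h3 := h1.unique (h2.congr_of_eventuallyEq (Filter.eventuallyEq_of_mem hnhds hA))
    simp only [id, Pi.add_apply] at h3
    linear_combination h3
  have hAz := hA z hz
  have hBz := hB z hz
  push_cast at eM eX
  constructor
  · rw [omegaXiPoly_eq ht₀ hs] at eX
    -- By `omegaXiPoly_eq`, this regular part of the right-hand side occurs identically in `eX` and
    -- the goal, so its form no longer matters.
    generalize (1 - s * χ₀) * (2 * b z - 1) / t₀ - (2 + s * χ₀) * a z
        + z * (2 * b z - 1) * (2 * s * a z + ((s - χ₀) / (2 * t₀) + z * a z) ^ 2) = B at eX ⊢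
    have hA₀ : 2 * t₀ * (s * (χ₀ ^ 2 - 1) / (2 * t₀)) = s * (χ₀ ^ 2 - 1) :=
      mul_div_cancel₀ _ (mul_ne_zero two_ne_zero ht₀)
    have h₆ : 6 * t₀ ≠ 0 := mul_ne_zero (by norm_num) ht₀
    apply mul_left_cancel₀ h₆
    -- The Euler relations remove `deriv M z` and `deriv X z`; the undifferentiated equations `hAz`,
    -- `hBz` remove the remaining multiples of `M z` and `X z`; `hmu₀` cancels the constants.
    linear_combination z * dA + 4 * z * eM + 2 * z * eX + 3 * hAz - 12 * hBz - 3 * hmu₀ - 3 * hA₀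
  · simp only [omegaMuPoly] at eM
    linear_combination dB + eM

end PainleveRoot

/-! ### Translation back to `t = t₀ + z`. -/

open PainleveRoot Metric in
theorem mainTheorem4 (s χ₀ χi t₀ lamIII : ℂ) (hs : s = 1 ∨ s = -1) (ht₀ : t₀ ≠ 0) :
    ∃ r : ℝ, 0 < r ∧ ∃ lam mu : ℂ → ℂ,
      DifferentiableOn ℂ lam (Metric.ball t₀ r) ∧
      DifferentiableOn ℂ mu (Metric.ball t₀ r) ∧
      PainleveRoot.IntEqMu s χ₀ χi t₀ lam mu (Metric.ball t₀ r) ∧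
      PainleveRoot.IntEqLam s χ₀ χi t₀ lam mu (Metric.ball t₀ r) ∧
      PainleveRoot.ODELam s χ₀ t₀ lam mu (Metric.ball t₀ r) ∧
      PainleveRoot.ODEMu s χ₀ χi t₀ lam mu (Metric.ball t₀ r) ∧
      lam t₀ = lamIII ∧
      mu t₀ = (1 + s * (1 - χ₀ ^ 2) / (2 * t₀) + 3 * t₀ * lamIII) / 2 := by
  obtain ⟨r, hr, a, b, ha, hb, hab⟩ := exists_solution_integralEquations s χ₀ t₀
    ((χi + s * χ₀ - 1) / 2) lamIII ((1 + s * (1 - χ₀ ^ 2) / (2 * t₀) + 3 * t₀ * lamIII) / 2)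
  have hs2 : s ^ 2 = 1 := by rcases hs with rfl | rfl <;> norm_num
  have hode := fun z (hz : z ∈ ball (0 : ℂ) r) =>
    differentialEquations_of_integralEquations ht₀ hs2 (by field_simp; ring) ha hb hab hz
  have hmem : ∀ {t : ℂ}, t ∈ ball t₀ r → t - t₀ ∈ ball (0 : ℂ) r := fun ht => by
    rwa [mem_ball_zero_iff, ← mem_ball_iff_norm]
  have ha0 : a 0 = lamIII := by simpa using (hab 0 (mem_ball_self hr)).1
  have hb0 := (hab 0 (mem_ball_self hr)).2
  rw [zero_div, zero_mul, add_zero] at hb0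
  have hda : DifferentiableOn ℂ (fun t => a (t - t₀)) (ball t₀ r) :=
    ha.comp (differentiableOn_id.sub_const t₀) fun t ht => hmem ht
  have hdb : DifferentiableOn ℂ (fun t => b (t - t₀)) (ball t₀ r) :=
    hb.comp (differentiableOn_id.sub_const t₀) fun t ht => hmem ht
  have hodeLam : ∀ t ∈ ball t₀ r, t ≠ t₀ → t * deriv (fun t => a (t - t₀)) t
      = WLam s χ₀ t₀ (fun t => a (t - t₀)) (fun t => b (t - t₀)) (t - t₀) t := by
    intro t ht hne
    have hsub : t - t₀ ≠ 0 := sub_ne_zero.2 hne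
    have h := (hode _ (hmem ht)).1
    rw [add_sub_cancel] at h
    rw [deriv_comp_sub_const]
    refine mul_left_cancel₀ hsub (h.trans ?_)
    simp only [WLam, mul_add, mul_sub, mul_div_cancel₀ _ hsub]
    ring
  refine ⟨r, hr, fun t => a (t - t₀), fun t => b (t - t₀), hda, hdb, ?_, ?_, ⟨hodeLam, ?_⟩,
    ?_, by simpa using ha0, by simpa using hb0⟩
  · intro t ht
    rw [integral_omegaMu]
    simp only [sub_self, ha0]
    linear_combination (hab _ (hmem ht)).2
  · intro t ht
    rw [integral_omegaLam s χ₀ t₀ ha.continuousOn hb.continuousOn (hmem ht)]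
    simp only [sub_self, ha0]
    linear_combination (hab _ (hmem ht)).1
  · intro h₀
    -- Away from `t₀` the right-hand side equals `t * deriv lam t`, which is continuous at `t₀`;
    -- this gives the limit.
    have hcont : ContinuousAt (fun t => t * deriv (fun t => a (t - t₀)) t) t₀ :=
      continuousAt_id.mul ((hda.deriv isOpen_ball).continuousOn.continuousAt
        (isOpen_ball.mem_nhds h₀))
    refine (hcont.tendsto.mono_left nhdsWithin_le_nhds).congr' ?_
    filter_upwards [self_mem_nhdsWithin, nhdsWithin_le_nhds (isOpen_ball.mem_nhds h₀)] with t hne ht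
    exact hodeLam t ht hne
  · intro t ht
    have h := (hode _ (hmem ht)).2
    rw [add_sub_cancel] at h
    rw [deriv_comp_sub_const, h]
    simp only [WMu]
    ring
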